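/- Assume $\diamondsuit^+$: there are countable families $(\mathcal A_\alpha)_{\alpha<\omega_1}$ such that for every $X\subseteq\omega_1$ there is a club $C\subseteq\omega_1$ with $C\cap\alpha\in\mathcal A_\alpha$ and $X\cap\alpha\in\mathcal A_\alpha$ for all $\alpha\in C$. Let $2^{<\omega_1}$ be the set of functions from a countable ordinal to $2=\{0,1\}$, ordered by end-extension. For downward closed $T\subseteq 2^{<\omega_1}$ put $T_\alpha=T\cap 2^\alpha$ and $T\upharpoonright\alpha=\bigcup_{\beta<\alpha}T_\beta$; such a $T$ is an $\aleph_1$-subtree if every level $T_\alpha$ ($\alpha<\omega_1$) is countable and non-empty. It is regular if it has a root, every node has at least two immediate successors in $T$, and every $s\in T_\alpha$ has an extension in $T_\beta$ for all $\alpha<\beta<\omega_1$. An Aronszajn tree is a regular $\aleph_1$-tree without uncountable branches; it is Suslin if it has no uncountable antichain, and special if it is the union of countably many antichains. Then there is a map $X\mapsto T^X$ from the subsets of $\omega_1$ to the downward closed $\aleph_1$-subtrees of $2^{<\omega_1}$ such that 1. for all $X,Y\subseteq\omega_1$ and $\alpha<\omega_1$, if $X\cap\alpha=Y\cap\alpha$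 then $T^X\upharpoonright\alpha=T^Y\upharpoonright\alpha$; 2. if $X$ is stationary in $\omega_1$, then $T^X$ is a Suslin tree; 3. if $X$ is non-stationary, then $T^X$ is a special Aronszajn tree. -/

import Mathlib

open scoped Ordinal

/-- The first uncountable ordinal `ω₁`, as the type of all countable ordinals. -/
abbrev OmegaOne : Type 1 := Set.Iio (ω₁ : Ordinal.{0})

/-- The principle `◇⁺`: there are countable families `A α` (`α < ω₁`) such that for every `X ⊆ ω₁`
there is a club `C ⊆ ω₁` with `C ∩ α ∈ A α` and `X ∩ α ∈ A α` for all `α ∈ C`. -/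
def DiamondPlus : Prop :=
  ∃ A : OmegaOne → Set (Set OmegaOne),
    (∀ α, (A α).Countable) ∧
    ∀ X : Set OmegaOne, ∃ C : Set OmegaOne, IsClub C ∧
      ∀ α ∈ C, C ∩ Set.Iio α ∈ A α ∧ X ∩ Set.Iio α ∈ A α

/-- The elements of `2^{<ω₁}`: a countable ordinal `len`, and a function from `len`
(the set of ordinals below it) to `2`. -/
structure BinSeq where
  len : OmegaOne
  val : Set.Iio len → Bool

namespace BinSeq

/-- `2^{<ω₁}` is ordered by end-extension: `s ≤ t` if `s` is the restriction of `t` to `len s`. -/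
instance : PartialOrder BinSeq where
  le s t := ∃ h : s.len ≤ t.len, ∀ β : Set.Iio s.len, s.val β = t.val ⟨β.1, β.2.trans_le h⟩
  le_refl s := ⟨le_rfl, fun _ => rfl⟩
  le_trans s t u := by
    rintro ⟨h, hst⟩ ⟨k, htu⟩
    exact ⟨h.trans k, fun β => (hst β).trans (htu _)⟩
  le_antisymm s t := by
    rintro ⟨h, hst⟩ ⟨k, _⟩
    obtain ⟨a, f⟩ := s
    obtain ⟨b, g⟩ := t
    obtain rfl : a = b := le_antisymm h k
    congr 1
    exact funext hst

/-- The level `T_α = T ∩ 2^α`. In a downward closed `T` the predecessors of a node `t` are exactly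
the restrictions of `t` to the ordinals below `len t`, so the height of `t` in `T` is `len t`. -/
def level (T : Set BinSeq) (α : OmegaOne) : Set BinSeq := {t ∈ T | t.len = α}

/-- `T ↾ α`, the union of the levels `T_β` with `β < α`. -/
def restrict (T : Set BinSeq) (α : OmegaOne) : Set BinSeq := {t ∈ T | t.len < α}

/-- `T` is a downward closed `ℵ₁`-subtree of `2^{<ω₁}`: its levels `T_α` (`α < ω₁`) are countable
and non-empty. -/
structure IsAlephOneSubtree (T : Set BinSeq) : Prop where
  isLowerSet : IsLowerSet T
  countable_level : ∀ α, (level T α).Countable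
  nonempty_level : ∀ α, (level T α).Nonempty

/-- `T` is regular: it is rooted, every node has at least two immediate successors, and `T` is
pruned, that is, every node has extensions at all higher levels. (As `T` will be downward closed,
`s ⋖ t` means the same in `T` as in `2^{<ω₁}`.) -/
structure IsRegularTree (T : Set BinSeq) : Prop where
  rooted : ∃ r ∈ T, ∀ t ∈ T, r ≤ t
  splitting : ∀ s ∈ T, ∃ t ∈ T, ∃ u ∈ T, t ≠ u ∧ s ⋖ t ∧ s ⋖ u
  pruned : ∀ s ∈ T, ∀ β, s.len < β → ∃ t ∈ level T β, s ≤ t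

/-- An Aronszajn tree: a (regular) `ℵ₁`-tree without uncountable branches. Every chain extends to a
branch (a maximal chain), so this is the same as having no uncountable chain. -/
structure IsAronszajn (T : Set BinSeq) : Prop where
  isAlephOneSubtree : IsAlephOneSubtree T
  isRegularTree : IsRegularTree T
  countable_of_isChain : ∀ b ⊆ T, IsChain (· ≤ ·) b → b.Countable

/-- A Suslin tree: an Aronszajn tree without uncountable antichains. -/
structure IsSuslin (T : Set BinSeq) : Prop where
  isAronszajn : IsAronszajn T
  countable_of_isAntichain : ∀ A ⊆ T, IsAntichain (· ≤ ·) A → A.Countable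

/-- A special Aronszajn tree: an Aronszajn tree that is the union of countably many antichains. -/
structure IsSpecialAronszajn (T : Set BinSeq) : Prop where
  isAronszajn : IsAronszajn T
  special : ∃ A : ℕ → Set BinSeq, (∀ n, IsAntichain (· ≤ ·) (A n)) ∧ T = ⋃ n, A n

end BinSeq

open Order

/-! The tree is built level by level, each level chosen from `X` up to its height and the earlier
levels, so agreement of `X` and `Y` below `α` passes to the trees. Successor levels contain all
one-point extensions. A limit level `d` consists of countably many branches, and its task depends on
whether `d ∈ X`.

If `d ∈ X`, every new branch meets each predense set of nodes guessed at `d`. When `X` is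
stationary, some such `d` catches the predense set generated by an antichain, which therefore lies
below `d`: the tree is Suslin.

If `d ∉ X`, consider the closed sets `C` of limits that avoid `X` and are guessed at each of their
points (`guessed`). Along every new branch, the map sending `b ∈ C` to the number of the branch's
node at `b` within its level is finite-to-one. When `X` is non-stationary, ◇⁺ gives a club of this
kind. A node on a level in `C` is then coloured by its number and by how many of its predecessors on
levels in `C` share that number; both together separate comparable nodes.

The two tasks do not conflict: a guessed set cannot contain a point of `X`, so at `d ∈ X` it is
bounded below `d`. To keep the recursion going, nodes must have extensions whose numbers on finitely
many guessed sets exceed any given `m` (clause `exists_ext` of `IsGoodLevel`). The work is in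
`exists_isGoodLevel_of_mem` and `exists_isGoodLevel_of_notMem`; the payoff is in
`countable_of_isAntichain_tree` and `exists_special_tree`. -/

/-! ### Countable ordinals and clubs. -/

theorem OmegaOne.countable_Iio (a : OmegaOne) : (Set.Iio a).Countable := by
  have h : (Set.Iio a.1).Countable := by
    have ha : a.1.card < Cardinal.aleph 1 := by
      rw [← Cardinal.lt_ord, Cardinal.ord_aleph]
      exact a.2
    rw [← Cardinal.succ_aleph0, Order.lt_succ_iff] at ha
    rw [← Cardinal.le_aleph0_iff_set_countable, Cardinal.mk_Iio_ordinal, Cardinal.lift_le_aleph0]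
    exact ha
  exact (h.preimage Subtype.val_injective).mono fun x hx => hx

theorem OmegaOne.countable_Iic (a : OmegaOne) : (Set.Iic a).Countable := by
  rw [← Set.Iio_union_right]
  exact (countable_Iio a).union (Set.countable_singleton a)

instance : NoMaxOrder OmegaOne where
  exists_gt a := ⟨⟨Order.succ a.1,
    (Cardinal.isSuccLimit_omega 1).succ_lt a.2⟩, Order.lt_succ a.1⟩

instance : Nonempty OmegaOne := ⟨⟨0, Ordinal.omega_pos 1⟩⟩

noncomputable instance : OrderBot OmegaOne := WellFoundedLT.toOrderBot _

theorem OmegaOne.cof_eq : Order.cof OmegaOne = Cardinal.aleph 1 := by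
  rw [Ordinal.cof_Iio, Ordinal.lift_omega, Ordinal.lift_one, Cardinal.cof_omega_one]

theorem OmegaOne.cof_ne_aleph0 : Order.cof OmegaOne ≠ Cardinal.aleph0 := by
  rw [cof_eq]; exact Cardinal.aleph0_lt_aleph_one.ne'

theorem OmegaOne.exists_forall_lt {S : Set OmegaOne} (hS : S.Countable) : ∃ b, ∀ a ∈ S, a < b := by
  have : ¬ IsCofinal S := by
    intro h
    have := (Order.cof_le h).trans (Cardinal.le_aleph0_iff_set_countable.2 hS)
    rw [cof_eq] at this
    exact Cardinal.aleph0_lt_aleph_one.not_ge this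
  simpa [IsCofinal] using this

/-- Codes a node, given by its height and its number in its level, as a countable ordinal, so that
◇⁺ can guess sets of nodes. -/
theorem OmegaOne.exists_injective : ∃ c : OmegaOne × ℕ → OmegaOne, Function.Injective c := by
  have : Cardinal.mk (OmegaOne × ℕ) = Cardinal.mk OmegaOne := by
    rw [Cardinal.mk_prod, Cardinal.mk_Iio_ordinal]
    simp
  obtain ⟨e⟩ := Cardinal.eq.1 this
  exact ⟨e, e.injective⟩

/-- The ordinals closed under a function form a club. -/
theorem OmegaOne.isClub_closurePoints (g : OmegaOne → OmegaOne) :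
    IsClub {a : OmegaOne | ∀ b < a, g b < a} := by
  constructor
  · rw [dirSupClosed_iff_of_linearOrder]
    intro d hd hne a ha b hb
    obtain ⟨x, hx, hbx⟩ := (lt_isLUB_iff ha).1 hb
    exact (hd hx b hbx).trans_le (ha.1 hx)
  · intro a
    have step : ∀ x : OmegaOne, ∃ y, x < y ∧ ∀ b ≤ x, g b < y := by
      intro x
      obtain ⟨y, hy⟩ := exists_forall_lt (((countable_Iic x).image g).insert x)
      exact ⟨y, hy x (by simp), fun b hb => hy _ (Or.inr ⟨b, hb, rfl⟩)⟩
    choose f hf hf' using step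
    let u : ℕ → OmegaOne := fun n => f^[n] a
    have hu : ∀ n, u (n + 1) = f (u n) := fun n => Function.iterate_succ_apply' f n a
    obtain ⟨y, hy⟩ := exists_forall_lt (Set.countable_range u)
    have hU : {y | ∀ n, u n < y}.Nonempty := ⟨y, fun n => hy _ ⟨n, rfl⟩⟩
    let z := wellFounded_lt.min _ hU
    have hz : ∀ n, u n < z := wellFounded_lt.min_mem _ hU
    have hz' : ∀ b < z, ∃ n, b ≤ u n := by
      intro b hb
      by_contra! h
      exact wellFounded_lt.not_lt_min {y | ∀ n, u n < y} h hb
    refine ⟨z, fun b hb => ?_, (hz 0).le⟩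
    obtain ⟨n, hn⟩ := hz' b hb
    exact ((hf' _ _ hn).trans_eq (hu n).symm).trans (hz _)

theorem OmegaOne.isClub_isSuccLimit : IsClub {a : OmegaOne | IsSuccLimit a} := by
  have h := (isClub_closurePoints Order.succ).inter cof_ne_aleph0
    (isClub_closurePoints fun _ => Order.succ ⊥)
  convert! IsClub.inter cof_ne_aleph0 h (t := Set.Ioi ⊥) ?_ using 1
  · ext a
    constructor
    · intro ha
      have h0 : ⊥ < a := ha.bot_lt
      exact ⟨⟨fun b hb => ha.succ_lt hb, fun b _ => ha.succ_lt h0⟩, h0⟩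
    · rintro ⟨⟨h1, -⟩, h0⟩
      refine ⟨fun h => h.not_lt h0, fun b hb => ?_⟩
      exact (h1 b hb.lt).ne hb.succ_eq
  · refine ⟨?_, fun a => ⟨Order.succ a, (bot_le).trans_lt (Order.lt_succ a), Order.le_succ a⟩⟩
    exact (isUpperSet_Ioi _).dirSupClosed

/-- A countable limit ordinal is the limit of a strictly increasing sequence. -/
theorem OmegaOne.exists_seq {d c : OmegaOne} (hd : IsSuccLimit d) (hc : c < d) :
    ∃ u : ℕ → OmegaOne, u 0 = c ∧ StrictMono u ∧ (∀ n, u n < d) ∧ ∀ b < d, ∃ n, b < u n := by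
  have : Countable (Set.Iio d) := (countable_Iio d).to_subtype
  have : Nonempty (Set.Iio d) := ⟨⟨c, hc⟩⟩
  obtain ⟨x, hx⟩ := exists_surjective_nat (Set.Iio d)
  let u : ℕ → Set.Iio d := fun n => Nat.rec ⟨c, hc⟩
    (fun n y => ⟨Order.succ (max y.1 (x n).1), hd.succ_lt (max_lt y.2 (x n).2)⟩) n
  have hu : ∀ n, (u (n + 1)).1 = Order.succ (max (u n).1 (x n).1) := fun n => rfl
  refine ⟨fun n => (u n).1, rfl, strictMono_nat_of_lt_succ fun n => ?_, fun n => (u n).2, ?_⟩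
  · rw [hu]; exact Order.lt_succ_of_le (le_max_left _ _)
  · intro b hb
    obtain ⟨n, hn⟩ := hx ⟨b, hb⟩
    refine ⟨n + 1, ?_⟩
    refine lt_of_lt_of_eq (Order.lt_succ_of_le ?_) (hu n).symm
    rw [hn]; exact le_max_right _ _

/-- A closed set which has an element `≤ a` has a greatest one. -/
theorem OmegaOne.exists_isGreatest {C : Set OmegaOne} (hC : DirSupClosed C) {a : OmegaOne}
    (h : (C ∩ Set.Iic a).Nonempty) : ∃ m, IsGreatest (C ∩ Set.Iic a) m := by
  let U := upperBounds (C ∩ Set.Iic a)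
  have hU : U.Nonempty := ⟨a, fun x hx => hx.2⟩
  let m := wellFounded_lt.min U hU
  have hm : IsLUB (C ∩ Set.Iic a) m :=
    ⟨wellFounded_lt.min_mem U hU, fun x hx => not_lt.1 (wellFounded_lt.not_lt_min U hx)⟩
  refine ⟨m, ⟨?_, hm.2 fun x hx => hx.2⟩, hm.1⟩
  exact dirSupClosed_iff_of_linearOrder.1 hC Set.inter_subset_left h hm

/-! ### Restriction, extension and limits of binary sequences. -/

namespace BinSeq

open Classical in
/-- The entries of a sequence, extended by `false`. -/
noncomputable def entry (s : BinSeq) (b : OmegaOne) : Bool :=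
  if h : b < s.len then s.val ⟨b, h⟩ else false

/-- The sequence of length `a` with the entries of `f`. -/
def ofFun (a : OmegaOne) (f : OmegaOne → Bool) : BinSeq := ⟨a, fun b => f b⟩

/-- The restriction of a sequence to `a`. -/
noncomputable def res (s : BinSeq) (a : OmegaOne) : BinSeq := ofFun a s.entry

@[simp] theorem len_ofFun (a f) : (ofFun a f).len = a := rfl

@[simp] theorem len_res (s a) : (res s a).len = a := rfl

theorem entry_ofFun {a b f} (h : b < a) : (ofFun a f).entry b = f b := by
  simp [entry, h, ofFun]

theorem entry_res {s : BinSeq} {a b : OmegaOne} (h : b < a) : (s.res a).entry b = s.entry b :=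
  entry_ofFun h

theorem ext_entry {s t : BinSeq} (h : s.len = t.len) (h' : ∀ b < s.len, s.entry b = t.entry b) :
    s = t := by
  obtain ⟨a, f⟩ := s
  obtain ⟨b, g⟩ := t
  obtain rfl : a = b := h
  congr 1
  funext x
  have := h' x.1 x.2
  simpa [entry, show x.1 < a from x.2] using this

theorem le_iff {s t : BinSeq} : s ≤ t ↔ s.len ≤ t.len ∧ ∀ b < s.len, s.entry b = t.entry b := by
  constructor
  · rintro ⟨h, h'⟩
    refine ⟨h, fun b hb => ?_⟩
    simpa [entry, hb, hb.trans_le h] using h' ⟨b, hb⟩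
  · rintro ⟨h, h'⟩
    refine ⟨h, fun b => ?_⟩
    have hb : b.1 < s.len := b.2
    simpa [entry, hb, hb.trans_le h] using h' b.1 hb

theorem len_mono {s t : BinSeq} (h : s ≤ t) : s.len ≤ t.len := h.1

theorem res_le {s : BinSeq} {a : OmegaOne} (h : a ≤ s.len) : s.res a ≤ s :=
  le_iff.2 ⟨h, fun _ hb => entry_res hb⟩

theorem res_eq_of_le {s t : BinSeq} (h : s ≤ t) : t.res s.len = s :=
  ext_entry rfl fun b hb => by
    rw [len_res] at hb
    rw [entry_res hb, (le_iff.1 h).2 b hb]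

theorem res_len (s : BinSeq) : s.res s.len = s := res_eq_of_le le_rfl

theorem res_res {s : BinSeq} {a b : OmegaOne} (h : a ≤ b) : (s.res b).res a = s.res a :=
  ext_entry rfl fun c hc => by
    rw [len_res] at hc
    rw [entry_res hc, entry_res hc, entry_res (hc.trans_le h)]

theorem res_congr {s t : BinSeq} (h : s ≤ t) {a : OmegaOne} (ha : a ≤ s.len) :
    s.res a = t.res a := by
  rw [← res_eq_of_le h, res_res ha]

theorem le_res {s t : BinSeq} (h : s ≤ t) {a : OmegaOne} (ha : s.len ≤ a) : s ≤ t.res a := by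
  rw [← res_eq_of_le h, ← res_res ha]
  exact res_le ha

theorem le_of_le_of_len_le {s t u : BinSeq} (hs : s ≤ u) (ht : t ≤ u) (h : s.len ≤ t.len) :
    s ≤ t := by
  rw [← res_eq_of_le ht]
  exact le_res hs h

theorem eq_of_le_of_len_le {s t : BinSeq} (hs : s ≤ t) (h : t.len ≤ s.len) : s = t :=
  le_antisymm hs (le_of_le_of_len_le le_rfl hs h)

/-- The one-point extension of a sequence. -/
noncomputable def snoc (s : BinSeq) (i : Bool) : BinSeq :=
  ofFun (succ s.len) fun b => if b = s.len then i else s.entry b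

@[simp] theorem len_snoc (s i) : (snoc s i).len = succ s.len := rfl

theorem res_snoc (s i) : (snoc s i).res s.len = s :=
  ext_entry rfl fun b hb => by
    rw [len_res] at hb
    rw [entry_res hb, snoc, entry_ofFun (hb.trans (lt_succ _)), if_neg hb.ne]

theorem le_snoc (s i) : s ≤ snoc s i := by
  conv_lhs => rw [← res_snoc s i]
  exact res_le (le_succ _)

theorem entry_snoc (s i) : (snoc s i).entry s.len = i := by
  rw [snoc, entry_ofFun (lt_succ _), if_pos rfl]

theorem snoc_injective (s) : Function.Injective (snoc s) := fun i j h => by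
  rw [← entry_snoc s i, h, entry_snoc]

theorem covBy_snoc (s i) : s ⋖ snoc s i := by
  refine ⟨lt_of_le_of_ne (le_snoc s i) fun h => (lt_succ s.len).ne (congrArg len h), fun u h h' => ?_⟩
  rcases (len_mono h'.le).lt_or_eq with hu | hu
  · exact h.ne (eq_of_le_of_len_le h.le (lt_succ_iff.1 hu))
  · exact h'.ne (eq_of_le_of_len_le h'.le hu.ge)

theorem eq_snoc {t : BinSeq} {a : OmegaOne} (h : t.len = succ a) :
    t = snoc (t.res a) (t.entry a) := by
  refine ext_entry h fun b hb => ?_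
  rw [h, lt_succ_iff] at hb
  rcases hb.lt_or_eq with hb | rfl
  · exact (entry_res hb).symm.trans ((le_iff.1 (le_snoc (t.res a) _)).2 b hb)
  · exact (entry_snoc (t.res b) _).symm

/-- An increasing sequence of nodes has a limit at every ordinal at which their lengths are
cofinal. -/
theorem exists_limit {s : ℕ → BinSeq} (hs : Monotone s) {d : OmegaOne} (hd : ∀ n, (s n).len ≤ d) :
    ∃ t : BinSeq, t.len = d ∧ ∀ n, s n ≤ t := by
  classical
  let f : OmegaOne → Bool := fun b => if h : ∃ n, b < (s n).len then (s h.choose).entry b else false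
  refine ⟨ofFun d f, rfl, fun n => le_iff.2 ⟨hd n, fun b hb => ?_⟩⟩
  have h : ∃ n, b < (s n).len := ⟨n, hb⟩
  rw [entry_ofFun (hb.trans_le (hd n))]
  simp only [f, dif_pos h]
  rcases le_total n h.choose with h' | h'
  · exact (le_iff.1 (hs h')).2 b hb
  · exact ((le_iff.1 (hs h')).2 b h.choose_spec).symm

/-! ### Numbering of nodes and the requirements on a level. -/

open Classical in
/-- A choice of an injection of a countable set of nodes into `ℕ`. -/
noncomputable def enum (S : Set BinSeq) : BinSeq → ℕ :=
  if h : S.Countable then (Set.countable_iff_exists_injOn.1 h).choose else fun _ => 0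

theorem injOn_enum {S : Set BinSeq} (h : S.Countable) : Set.InjOn (enum S) S := by
  rw [enum, dif_pos h]
  exact (Set.countable_iff_exists_injOn.1 h).choose_spec

/-- The number of a node in the enumeration of its level. -/
noncomputable def num (L : OmegaOne → Set BinSeq) (t : BinSeq) : ℕ := enum (L t.len) t

/-- The nodes of height less than `d`. -/
def below (L : OmegaOne → Set BinSeq) (d : OmegaOne) : Set BinSeq := {t | t.len < d ∧ t ∈ L t.len}

/-- The closed sets of limit ordinals `≤ d` that avoid `X` and are guessed by `A` at each of their
elements. -/
def guessed (A : OmegaOne → Set (Set OmegaOne)) (X : Set OmegaOne) (d : OmegaOne) :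
    Set (Set OmegaOne) :=
  {C | C ⊆ Set.Iic d ∧ DirSupClosed C ∧ ∀ b ∈ C, IsSuccLimit b ∧ b ∉ X ∧ C ∩ Set.Iio b ∈ A b}

/-- The conditions on the level `L d`, given the levels below it. -/
structure IsGoodLevel (A : OmegaOne → Set (Set OmegaOne)) (c : OmegaOne × ℕ → OmegaOne)
    (X : Set OmegaOne) (L : OmegaOne → Set BinSeq) (d : OmegaOne) : Prop where
  nonempty : d = ⊥ → (L d).Nonempty
  len_eq : ∀ t ∈ L d, t.len = d
  res_mem : ∀ t ∈ L d, ∀ b ≤ d, t.res b ∈ L b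
  countable : (L d).Countable
  full : ∀ t : BinSeq, t.len = d → ∀ a, d = succ a → t.res a ∈ L a → t ∈ L d
  finite : ∀ C ∈ guessed A X d, ∀ t ∈ L d, ∀ k, {b ∈ C | num L (t.res b) = k}.Finite
  exists_ext : ∀ a < d, ∀ s ∈ L a, ∀ F ⊆ guessed A X d, F.Finite → ∀ m, ∃ t ∈ L d, s ≤ t ∧
    ∀ C ∈ F, ∀ b ∈ C, a < b → m ≤ num L (t.res b)
  sealing : IsSuccLimit d → d ∈ X → ∀ S ∈ A d,
    (∀ s ∈ below L d, ∃ a ∈ below L d, c (a.len, num L a) ∈ S ∧ (a ≤ s ∨ s ≤ a)) →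
    ∀ t ∈ L d, ∃ a ∈ below L d, c (a.len, num L a) ∈ S ∧ a ≤ t

variable {A : OmegaOne → Set (Set OmegaOne)} {c : OmegaOne × ℕ → OmegaOne} {X Y : Set OmegaOne}
  {L L' : OmegaOne → Set BinSeq} {a b d : OmegaOne}

theorem guessed_congr (h : X ∩ Set.Iic d = Y ∩ Set.Iic d) : guessed A X d = guessed A Y d := by
  ext C
  refine and_congr_right fun hC => and_congr_right fun _ => forall₂_congr fun b hb => ?_
  have : b ∈ X ↔ b ∈ Y := by
    have := Set.ext_iff.1 h b
    simpa [show b ≤ d from hC hb] using this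
  rw [this]

theorem num_congr {t : BinSeq} (h : L t.len = L' t.len) : num L t = num L' t := by
  rw [num, num, h]

theorem below_congr (h : ∀ b < d, L b = L' b) : below L d = below L' d := by
  ext t
  exact and_congr_right fun ht => by rw [h _ ht]

/-- Goodness at `d` is local: all clauses look at `X` and `L` only up to `d`. Hence the recursion
may cut `X` off at `d` and put junk values above `d`. -/
theorem IsGoodLevel.congr (h : IsGoodLevel A c X L d) (hX : X ∩ Set.Iic d = Y ∩ Set.Iic d)
    (hL : ∀ b ≤ d, L b = L' b) : IsGoodLevel A c Y L' d := by
  have hd := hL d le_rfl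
  have hb : below L d = below L' d := below_congr fun b hb => hL b hb.le
  have hn : ∀ t ∈ below L' d, num L t = num L' t := fun t ht => num_congr (hL _ ht.1.le)
  have hg := guessed_congr (A := A) hX
  constructor
  · exact hd ▸ h.nonempty
  · exact hd ▸ h.len_eq
  · intro t ht b hb
    rw [← hL b hb]
    exact h.res_mem t (hd ▸ ht) b hb
  · exact hd ▸ h.countable
  · intro t ht a ha hr
    rw [← hd]
    refine h.full t ht a ha ?_
    rwa [hL a (ha ▸ le_succ a)]
  · intro C hC t ht k
    refine (h.finite C (hg ▸ hC) t (hd ▸ ht) k).subset fun b hb => ⟨hb.1, ?_⟩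
    rw [num_congr (hL (t.res b).len (hC.1 hb.1))]
    exact hb.2
  · intro a ha s hs F hF hF' m
    rw [← hL a ha.le] at hs
    obtain ⟨t, ht, hst, H⟩ := h.exists_ext a ha s hs F (hg ▸ hF) hF' m
    refine ⟨t, hd ▸ ht, hst, fun C hC b hb hab => ?_⟩
    rw [← num_congr (hL (t.res b).len ((hF hC).1 hb))]
    exact H C hC b hb hab
  · intro hl hdX S hS H t ht
    have hdX' : d ∈ X := by
      have := Set.ext_iff.1 hX d
      simpa [hdX] using this
    have := h.sealing hl hdX' S hS
    rw [hb, hd] at this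
    obtain ⟨a, ha, hc, hat⟩ := this (fun s hs => by
      obtain ⟨a, ha, hc, hsa⟩ := H s hs
      exact ⟨a, ha, by rwa [hn a ha], hsa⟩) t ht
    exact ⟨a, ha, by rwa [← hn a ha], hat⟩

/-! ### Canonical recursive choice of the levels. -/

variable (A c X) in
open Classical in
/-- The levels of the tree, chosen by recursion. -/
noncomputable def levels : OmegaOne → Set BinSeq :=
  wellFounded_lt.fix fun d ih => Classical.epsilon fun l =>
    IsGoodLevel A c (X ∩ Set.Iic d)
      (Function.update (fun b => if h : b < d then ih b h else ∅) d l) d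

open Classical in
theorem levels_eq (d : OmegaOne) : levels A c X d = Classical.epsilon fun l =>
    IsGoodLevel A c (X ∩ Set.Iic d)
      (Function.update (fun b => if b < d then levels A c X b else ∅) d l) d := by
  rw [levels, wellFounded_lt.fix_eq]
  rfl

theorem levels_congr (h : X ∩ Set.Iic d = Y ∩ Set.Iic d) : levels A c X d = levels A c Y d := by
  induction d using WellFoundedLT.induction with
  | ind d ih =>
    rw [levels_eq, levels_eq, h]
    congr! 5 with l b
    split_ifs with hb
    · refine ih b hb ?_
      have := congrArg (· ∩ Set.Iic b) h
      simpa [Set.inter_assoc, hb.le] using this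
    · rfl

/-- The levels are good, provided that a good level can always be added. -/
theorem isGoodLevel_levels
    (H : ∀ (L : OmegaOne → Set BinSeq) (d : OmegaOne), (∀ b < d, IsGoodLevel A c X L b) →
      ∃ l, IsGoodLevel A c X (Function.update L d l) d) (d : OmegaOne) :
    IsGoodLevel A c X (levels A c X) d := by
  classical
  induction d using WellFoundedLT.induction with
  | ind d ih =>
    obtain ⟨l, hl⟩ := H (levels A c X) d ih
    have hX : ∀ Z : Set OmegaOne, Z ∩ Set.Iic d = (Z ∩ Set.Iic d) ∩ Set.Iic d := fun Z => by
      rw [Set.inter_assoc, Set.inter_self]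
    have key := Classical.epsilon_spec (p := fun l => IsGoodLevel A c (X ∩ Set.Iic d)
      (Function.update (fun b => if b < d then levels A c X b else ∅) d l) d) ⟨l, by
        refine hl.congr (hX X) fun b hb => ?_
        rcases hb.lt_or_eq with hb | rfl
        · simp [hb, hb.ne]
        · simp⟩
    rw [← levels_eq] at key
    refine key.congr (hX X).symm fun b hb => ?_
    rcases hb.lt_or_eq with hb | rfl
    · simp [hb, hb.ne]
    · simp

/-! ### Guessed sets and extensions below a given level. -/

theorem inter_Iic_mem_guessed_of_dirSupClosed {C : Set OmegaOne} (hcl : DirSupClosed C)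
    (hC : ∀ a ∈ C, IsSuccLimit a ∧ a ∉ X ∧ C ∩ Set.Iio a ∈ A a) (b : OmegaOne) :
    C ∩ Set.Iic b ∈ guessed A X b := by
  refine ⟨Set.inter_subset_right, hcl.inter (dirSupClosed_Iic b), fun x hx => ?_⟩
  obtain ⟨h1, h2, h3⟩ := hC x hx.1
  have : Set.Iic b ∩ Set.Iio x = Set.Iio x :=
    Set.inter_eq_right.2 fun y hy => (le_of_lt (Set.mem_Iio.1 hy)).trans hx.2
  refine ⟨h1, h2, ?_⟩
  rwa [Set.inter_assoc, this]

theorem inter_Iic_mem_guessed {C : Set OmegaOne} (hC : C ∈ guessed A X d) (b : OmegaOne) :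
    C ∩ Set.Iic b ∈ guessed A X b :=
  inter_Iic_mem_guessed_of_dirSupClosed hC.2.1 hC.2.2 b

/-- A nonempty guessed set is determined by its maximum `m` and its part below `m`, which belongs to
the countable family `A m`. -/
theorem countable_guessed (hA : ∀ b, (A b).Countable) : (guessed A X d).Countable := by
  have h : (⋃ b ∈ Set.Iic d, insert b '' A b).Countable :=
    (OmegaOne.countable_Iic d).biUnion fun b _ => (hA b).image _
  refine (h.insert ∅).mono fun C hC => ?_
  rcases C.eq_empty_or_nonempty with hne | hne
  · exact Or.inl hne
  have hd : C ∩ Set.Iic d = C := Set.inter_eq_left.2 hC.1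
  obtain ⟨m, hm⟩ := OmegaOne.exists_isGreatest hC.2.1 (a := d) (by rwa [hd])
  rw [hd] at hm
  refine Or.inr (Set.mem_iUnion₂.2 ⟨m, hC.1 hm.1, C ∩ Set.Iio m, (hC.2.2 m hm.1).2.2, ?_⟩)
  ext x
  constructor
  · rintro (rfl | hx)
    exacts [hm.1, hx.1]
  · intro hx
    rcases (hm.2 hx).eq_or_lt with h | h
    exacts [Or.inl h, Or.inr ⟨hx, h⟩]

theorem exists_subset_Iic_of_mem_guessed {C : Set OmegaOne} (hC : C ∈ guessed A X d) (hd : d ∉ C)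
    (hd' : IsSuccLimit d) : ∃ b < d, C ⊆ Set.Iic b := by
  rcases C.eq_empty_or_nonempty with rfl | hne
  · exact ⟨⊥, hd'.bot_lt, Set.empty_subset _⟩
  have hC' : C ∩ Set.Iic d = C := Set.inter_eq_left.2 hC.1
  obtain ⟨m, hm⟩ := OmegaOne.exists_isGreatest hC.2.1 (a := d) (by rwa [hC'])
  rw [hC'] at hm
  exact ⟨m, lt_of_le_of_ne (hC.1 hm.1) fun h => hd (h ▸ hm.1), hm.2⟩

theorem countable_below (hL : ∀ b < d, IsGoodLevel A c X L b) : (below L d).Countable :=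
  ((OmegaOne.countable_Iio d).biUnion fun b hb => (hL b hb).countable).mono fun t ht =>
    Set.mem_iUnion₂.2 ⟨t.len, ht.1, ht.2⟩

theorem mem_below (hL : ∀ b < d, IsGoodLevel A c X L b) (hb : b < d) {t : BinSeq} (ht : t ∈ L b) :
    t ∈ below L d := by
  have := (hL b hb).len_eq t ht
  exact ⟨this.trans_lt hb, this.symm ▸ ht⟩

/-- The extension property, with bounds required only up to the level reached. -/
theorem exists_ext_of_le (hL : ∀ b < d, IsGoodLevel A c X L b) (hb : b < d) (hab : a ≤ b)
    {s : BinSeq} (hs : s ∈ L a) {F : Set (Set OmegaOne)} (hF : F ⊆ guessed A X d) (hF' : F.Finite)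
    (m : ℕ) : ∃ t ∈ L b, s ≤ t ∧ ∀ C ∈ F, ∀ x ∈ C, a < x → x ≤ b → m ≤ num L (t.res x) := by
  rcases hab.eq_or_lt with rfl | hab
  · exact ⟨s, hs, le_rfl, fun C hC x hx h h' => absurd h h'.not_gt⟩
  · obtain ⟨t, ht, hst, H⟩ := (hL b hb).exists_ext a hab s hs ((· ∩ Set.Iic b) '' F) (by
      rintro _ ⟨C, hC, rfl⟩
      exact inter_Iic_mem_guessed (hF hC) b) (hF'.image _) m
    exact ⟨t, ht, hst, fun C hC x hx h h' => H _ ⟨C, hC, rfl⟩ x ⟨hx, h'⟩ h⟩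

theorem exists_extension (hL : ∀ b < d, IsGoodLevel A c X L b) (hb : b < d) (hab : a ≤ b)
    {s : BinSeq} (hs : s ∈ L a) : ∃ t ∈ L b, s ≤ t := by
  obtain ⟨t, ht, hst, -⟩ := exists_ext_of_le hL hb hab hs (Set.empty_subset _) Set.finite_empty 0
  exact ⟨t, ht, hst⟩

/-! ### Adding one good level. -/

theorem exists_isGoodLevel_bot : ∃ l, IsGoodLevel A c X (Function.update L ⊥ l) ⊥ := by
  refine ⟨{ofFun ⊥ fun _ => false}, ?_⟩
  constructor <;> simp only [Function.update_self]
  · exact fun _ => ⟨_, rfl⟩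
  · rintro t rfl; rfl
  · rintro t rfl b hb
    obtain rfl := le_bot_iff.1 hb
    rw [Function.update_self]
    exact res_len _
  · exact Set.countable_singleton _
  · exact fun t ht a ha => absurd ha (bot_lt_succ a).ne
  · intro C hC t ht k
    refine (Set.finite_singleton ⊥).subset fun b hb => ?_
    exact le_bot_iff.1 (hC.1 hb.1)
  · exact fun a ha => absurd ha not_lt_bot
  · exact fun h => absurd rfl h.ne_bot

/-- Guessed sets consist of limit ordinals, so a successor level adds no new constraint and can
contain all one-point extensions. -/
theorem exists_isGoodLevel_succ (hL : ∀ b < succ a, IsGoodLevel A c X L b) :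
    ∃ l, IsGoodLevel A c X (Function.update L (succ a) l) (succ a) := by
  set l : Set BinSeq := {t | t.len = succ a ∧ t.res a ∈ L a}
  set L' := Function.update L (succ a) l
  have h1 : ∀ b ≤ a, L' b = L b := fun b hb =>
    Function.update_of_ne (lt_succ_of_le hb).ne _ _
  have h2 : L' (succ a) = l := Function.update_self ..
  have hn : ∀ t : BinSeq, t.len ≤ a → num L' t = num L t := fun t ht => num_congr (h1 _ ht)
  have ha := hL a (lt_succ a)
  have hC : ∀ C ∈ guessed A X (succ a), ∀ b ∈ C, b ≤ a := by
    intro C hC b hb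
    refine lt_succ_iff.1 (lt_of_le_of_ne (hC.1 hb) ?_)
    rintro rfl
    exact not_isSuccLimit_succ a (hC.2.2 _ hb).1
  refine ⟨l, ?_⟩
  change IsGoodLevel A c X L' (succ a)
  constructor
  · exact fun h => absurd h (bot_lt_succ a).ne'
  · rw [h2]; exact fun t ht => ht.1
  · rw [h2]
    intro t ht b hb
    rcases hb.eq_or_lt with rfl | hb
    · rw [← ht.1, res_len, ht.1, h2]
      exact ht
    · rw [lt_succ_iff] at hb
      rw [h1 b hb, ← res_res hb]
      exact ha.res_mem _ ht.2 b hb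
  · rw [h2]
    refine ((ha.countable.prod (Set.countable_univ (α := Bool))).image
      fun p => snoc p.1 p.2).mono ?_
    exact fun t ht => ⟨(t.res a, t.entry a), ⟨ht.2, trivial⟩, (eq_snoc ht.1).symm⟩
  · intro t ht b hb hr
    obtain rfl := succ_injective hb
    rw [h2]
    exact ⟨ht, h1 a le_rfl ▸ hr⟩
  · rw [h2]
    intro C hC' t ht k
    have := ha.finite _ (inter_Iic_mem_guessed hC' a) _ ht.2 k
    refine this.subset fun b hb => ?_
    have hba := hC C hC' b hb.1
    refine ⟨⟨hb.1, hba⟩, ?_⟩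
    rw [res_res hba, ← hn (t.res b) hba]
    exact hb.2
  · rw [h2]
    intro b hb s hs F hF hF' m
    rw [lt_succ_iff] at hb
    rw [h1 b hb] at hs
    obtain ⟨t, ht, hst, H⟩ := exists_ext_of_le hL (lt_succ a) hb hs hF hF' m
    have hta := ha.len_eq t ht
    have hr : (snoc t false).res a = t := hta ▸ res_snoc t false
    refine ⟨snoc t false, ⟨by rw [len_snoc, hta], hr.symm ▸ ht⟩, hst.trans (le_snoc _ _),
      fun C hC' x hx hbx => ?_⟩
    have hxa := hC C (hF hC') x hx
    rw [hn ((snoc t false).res x) hxa, ← res_res hxa, hr]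
    exact H C hC' x hx hbx hxa
  · exact fun h => absurd h (not_isSuccLimit_succ a)

/-- Branches through the levels below a limit are built in countably many steps. -/
theorem exists_branch (hd : IsSuccLimit d) (hL : ∀ b < d, IsGoodLevel A c X L b)
    (R : ℕ → BinSeq → BinSeq → Prop)
    (hR : ∀ n, ∀ p ∈ below L d, ∀ b < d, ∃ q ∈ below L d, p ≤ q ∧ b ≤ q.len ∧ R n p q)
    {s : BinSeq} (hs : s ∈ below L d) :
    ∃ (p : ℕ → BinSeq) (t : BinSeq), p 0 = s ∧ Monotone p ∧ (∀ n, p n ∈ below L d) ∧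
      (∀ n, R n (p n) (p (n + 1))) ∧ (∀ b < d, ∃ n, b ≤ (p n).len) ∧ t.len = d ∧
      (∀ n, p n ≤ t) ∧ ∀ b < d, t.res b ∈ L b := by
  obtain ⟨u, -, -, hu, hu'⟩ := OmegaOne.exists_seq hd hd.bot_lt
  choose! f hf hpf hbf hRf using hR
  -- Step `n` also climbs to the height `u n`, which makes the lengths cofinal in `d`.
  let P : ℕ → below L d := fun n => Nat.rec ⟨s, hs⟩ (fun n q => ⟨f n q.1 (u n), hf n _ q.2 _ (hu n)⟩) n
  let p : ℕ → BinSeq := fun n => (P n).1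
  have hp : ∀ n, p n ∈ below L d := fun n => (P n).2
  have hps : ∀ n, p (n + 1) = f n (p n) (u n) := fun n => rfl
  have hmono : Monotone p := monotone_nat_of_le_succ fun n => by
    rw [hps]; exact hpf n _ (hp n) _ (hu n)
  obtain ⟨t, ht, hpt⟩ := exists_limit hmono fun n => (hp n).1.le
  have hcof : ∀ b < d, ∃ n, b ≤ (p n).len := fun b hb => by
    obtain ⟨n, hn⟩ := hu' b hb
    refine ⟨n + 1, hn.le.trans ?_⟩
    rw [hps]; exact hbf n _ (hp n) _ (hu n)
  refine ⟨p, t, rfl, hmono, hp, fun n => ?_, hcof, ht, hpt, fun b hb => ?_⟩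
  · rw [hps]; exact hRf n _ (hp n) _ (hu n)
  · obtain ⟨n, hn⟩ := hcof b hb
    rw [← res_congr (hpt n) hn]
    exact (hL _ (hp n).1).res_mem _ (hp n).2 b hn

/-- A limit level which consists of branches is good under conditions on the levels below. -/
theorem isGoodLevel_limit (hd : IsSuccLimit d) {l : Set BinSeq} (hl : l.Countable)
    (hlen : ∀ t ∈ l, t.len = d) (hres : ∀ t ∈ l, ∀ b < d, t.res b ∈ L b)
    (hfin : ∀ C ∈ guessed A X d, ∀ t ∈ l, ∀ k, {b ∈ C | b < d ∧ num L (t.res b) = k}.Finite)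
    (hext : ∀ a < d, ∀ s ∈ L a, ∀ F ⊆ guessed A X d, F.Finite → ∀ m, ∃ t ∈ l, s ≤ t ∧
      (∀ C ∈ F, ∀ b ∈ C, a < b → b < d → m ≤ num L (t.res b)) ∧ ((∃ C ∈ F, d ∈ C) → m ≤ enum l t))
    (hseal : d ∈ X → ∀ S ∈ A d,
      (∀ s ∈ below L d, ∃ a ∈ below L d, c (a.len, num L a) ∈ S ∧ (a ≤ s ∨ s ≤ a)) →
      ∀ t ∈ l, ∃ a ∈ below L d, c (a.len, num L a) ∈ S ∧ a ≤ t) :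
    IsGoodLevel A c X (Function.update L d l) d := by
  set L' := Function.update L d l
  have h1 : ∀ b < d, L' b = L b := fun b hb => Function.update_of_ne hb.ne _ _
  have h2 : L' d = l := Function.update_self ..
  have hn : ∀ t : BinSeq, t.len < d → num L' t = num L t := fun t ht => num_congr (h1 _ ht)
  have hr : ∀ t ∈ l, t.res d = t := fun t ht => hlen t ht ▸ res_len t
  constructor
  · exact fun h => absurd h hd.ne_bot
  · rwa [h2]
  · rw [h2]
    intro t ht b hb
    rcases hb.eq_or_lt with rfl | hb
    · rwa [hr t ht, h2]
    · rw [h1 b hb]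
      exact hres t ht b hb
  · rwa [h2]
  · rintro t - b rfl
    exact absurd hd (not_isSuccLimit_succ b)
  · rw [h2]
    intro C hC t ht k
    refine ((hfin C hC t ht k).insert d).subset fun b hb => ?_
    rcases (Set.mem_Iic.1 (hC.1 hb.1)).eq_or_lt with h | h
    · exact Or.inl h
    · exact Or.inr ⟨hb.1, h, (hn (t.res b) h).symm.trans hb.2⟩
  · rw [h2]
    intro a ha s hs F hF hF' m
    rw [h1 a ha] at hs
    obtain ⟨t, ht, hst, H, H'⟩ := hext a ha s hs F hF hF' m
    refine ⟨t, ht, hst, fun C hC b hb hab => ?_⟩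
    rcases (Set.mem_Iic.1 ((hF hC).1 hb)).eq_or_lt with rfl | h
    · rw [hr t ht, num, hlen t ht, h2]
      exact H' ⟨C, hC, hb⟩
    · rw [hn (t.res b) h]
      exact H C hC b hb hab h
  · rw [h2, below_congr h1]
    intro _ hdX S hS H t ht
    obtain ⟨a, ha, haS, hat⟩ := hseal hdX S hS (fun s hs => by
      obtain ⟨a, ha, haS, hsa⟩ := H s hs
      exact ⟨a, ha, by rwa [← hn a ha.1], hsa⟩) t ht
    exact ⟨a, ha, by rwa [hn a ha.1], hat⟩

theorem exists_isGoodLevel_of_mem (hA : ∀ b, (A b).Countable) (hd : IsSuccLimit d) (hdX : d ∈ X)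
    (hL : ∀ b < d, IsGoodLevel A c X L b) :
    ∃ l, IsGoodLevel A c X (Function.update L d l) d := by
  obtain ⟨S, hS⟩ := Set.countable_iff_exists_subset_range.1 (hA d)
  have key : ∀ s ∈ below L d, ∃ t : BinSeq, t.len = d ∧ s ≤ t ∧ (∀ b < d, t.res b ∈ L b) ∧
      ∀ S ∈ A d, (∀ s ∈ below L d, ∃ a ∈ below L d, c (a.len, num L a) ∈ S ∧ (a ≤ s ∨ s ≤ a)) →
        ∃ a ∈ below L d, c (a.len, num L a) ∈ S ∧ a ≤ t := by
    intro s hs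
    obtain ⟨p, t, rfl, -, -, hR, -, htd, hpt, hres⟩ := exists_branch hd hL
      (fun n p q => (∀ s ∈ below L d, ∃ a ∈ below L d, c (a.len, num L a) ∈ S n ∧ (a ≤ s ∨ s ≤ a)) →
        ∃ a ∈ below L d, c (a.len, num L a) ∈ S n ∧ a ≤ q) (by
      intro n p hp b hb
      obtain ⟨q, hq, hpq⟩ := exists_extension hL (max_lt hp.1 hb) (le_max_left p.len b) hp.2
      have hqlen := (hL _ (max_lt hp.1 hb)).len_eq q hq
      have hq' := mem_below hL (max_lt hp.1 hb) hq
      have hbq : b ≤ q.len := hqlen ▸ le_max_right _ _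
      by_cases H : ∀ s ∈ below L d, ∃ a ∈ below L d,
          c (a.len, num L a) ∈ S n ∧ (a ≤ s ∨ s ≤ a)
      · obtain ⟨a, ha, haS, hqa | hqa⟩ := H q hq'
        · exact ⟨q, hq', hpq, hbq, fun _ => ⟨a, ha, haS, hqa⟩⟩
        · exact ⟨a, ha, hpq.trans hqa, hbq.trans (len_mono hqa), fun _ => ⟨a, ha, haS, le_rfl⟩⟩
      · exact ⟨q, hq', hpq, hbq, fun h => absurd h H⟩) hs
    refine ⟨t, htd, hpt 0, hres, fun S' hS' H => ?_⟩
    obtain ⟨n, rfl⟩ := hS hS'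
    obtain ⟨a, ha, haS, hap⟩ := hR n H
    exact ⟨a, ha, haS, hap.trans (hpt _)⟩
  choose! g hg hsg hres hseal using key
  have hC : ∀ C ∈ guessed A X d, ∃ b < d, C ⊆ Set.Iic b := fun C hC =>
    exists_subset_Iic_of_mem_guessed hC (fun h => (hC.2.2 d h).2.1 hdX) hd
  refine ⟨g '' below L d, isGoodLevel_limit hd ((countable_below hL).image g) ?_ ?_ ?_ ?_ ?_⟩
  · rintro _ ⟨s, hs, rfl⟩
    exact hg s hs
  · rintro _ ⟨s, hs, rfl⟩
    exact hres s hs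
  · rintro C hC' _ ⟨s, hs, rfl⟩ k
    obtain ⟨b, hb, hCb⟩ := hC C hC'
    refine ((hL b hb).finite _ (inter_Iic_mem_guessed hC' b) _ (hres s hs b hb) k).subset
      fun x hx => ⟨⟨hx.1, hCb hx.1⟩, ?_⟩
    rw [res_res (hCb hx.1)]
    exact hx.2.2
  · intro a ha s hs F hF hF' m
    -- The sets in `F` have a common bound `b < d`, so it suffices to meet the lower bound `m` up to
    -- level `b` and then follow any of the chosen branches.
    obtain ⟨b, hb, hab, hFb⟩ : ∃ b < d, a ≤ b ∧ ∀ C ∈ F, C ⊆ Set.Iic b := by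
      clear hs
      induction F, hF' using Set.Finite.induction_on with
      | empty => exact ⟨a, ha, le_rfl, fun C hC => absurd hC (Set.notMem_empty C)⟩
      | @insert C F _ _ ih =>
        obtain ⟨b, hb, hab, h⟩ := ih ((Set.subset_insert _ _).trans hF)
        obtain ⟨b', hb', h'⟩ := hC C (hF (Set.mem_insert _ _))
        refine ⟨max b b', max_lt hb hb', hab.trans (le_max_left _ _), ?_⟩
        rintro D (rfl | hD) x hx
        · exact (Set.mem_Iic.1 (h' hx)).trans (le_max_right _ _)
        · exact (Set.mem_Iic.1 (h D hD hx)).trans (le_max_left _ _)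
    obtain ⟨t, ht, hst, H⟩ := exists_ext_of_le hL hb hab hs hF hF' m
    have ht' := mem_below hL hb ht
    refine ⟨g t, ⟨t, ht', rfl⟩, hst.trans (hsg t ht'), fun C hC' x hx hax _ => ?_, ?_⟩
    · have hxb := hFb C hC' hx
      rw [← res_congr (hsg t ht') (((hL b hb).len_eq t ht).symm ▸ hxb)]
      exact H C hC' x hx hax hxb
    · rintro ⟨C, hC', hdC⟩
      exact absurd (hFb C hC' hdC) hb.not_ge
  · rintro - S' hS' H _ ⟨s, hs, rfl⟩
    exact hseal s hs S' hS' H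

/-- Below a limit, a node can be extended, without passing limit ordinals, to avoid finitely many
nodes. -/
theorem exists_avoiding (hd : IsSuccLimit d) (hL : ∀ b < d, IsGoodLevel A c X L b) {s : BinSeq}
    (hs : s ∈ below L d) {B : Set BinSeq} (hB : B.Finite) :
    ∃ q ∈ below L d, s ≤ q ∧ (∀ b, s.len < b → IsSuccLimit b → q.len < b) ∧ ∀ t ∈ B, ¬ q ≤ t := by
  induction B, hB using Set.Finite.induction_on with
  | empty => exact ⟨s, hs, le_rfl, fun b hb _ => hb, fun t ht => absurd ht (Set.notMem_empty t)⟩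
  | @insert t B _ _ ih =>
    obtain ⟨q, hq, hsq, hqb, hqB⟩ := ih
    obtain ⟨i, hi⟩ : ∃ i, ¬ snoc q i ≤ t := by
      by_contra! h
      have : snoc q true = snoc q false :=
        (res_eq_of_le (h true)).symm.trans (res_eq_of_le (h false))
      exact Bool.noConfusion (snoc_injective q this)
    have hq' : succ q.len < d := hd.succ_lt hq.1
    refine ⟨snoc q i, ⟨hq', (hL _ hq').full _ rfl _ rfl ?_⟩, hsq.trans (le_snoc q i),
      fun b hb hb' => hb'.succ_lt (hqb b hb hb'), ?_⟩
    · rw [res_snoc]; exact hq.2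
    · rintro u (rfl | hu)
      · exact hi
      · exact fun h => hqB u hu ((le_snoc q i).trans h)

/-- A fusion: stage `n` forces the numbers on the first guessed sets to be at least `m + n`, so
every guessed set eventually takes each number only below a fixed level. -/
theorem exists_isGoodLevel_of_notMem (hA : ∀ b, (A b).Countable) (hd : IsSuccLimit d) (hdX : d ∉ X)
    (hL : ∀ b < d, IsGoodLevel A c X L b) :
    ∃ l, IsGoodLevel A c X (Function.update L d l) d := by
  have hG := countable_guessed (X := X) (d := d) hA
  have key : ∀ s ∈ below L d, ∀ F ⊆ guessed A X d, F.Finite → ∀ m : ℕ, ∃ t : BinSeq,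
      t.len = d ∧ s ≤ t ∧ (∀ b < d, t.res b ∈ L b) ∧
      (∀ C ∈ guessed A X d, ∀ k, {b ∈ C | b < d ∧ num L (t.res b) = k}.Finite) ∧
      ∀ C ∈ F, ∀ b ∈ C, s.len < b → b < d → m ≤ num L (t.res b) := by
    intro s hs F hF hF' m
    have hG' : (guessed A X d).Nonempty :=
      ⟨∅, Set.empty_subset _, .empty, fun b hb => absurd hb (Set.notMem_empty b)⟩
    obtain ⟨E, hE⟩ := hG.exists_eq_range hG'
    obtain ⟨p, t, rfl, hmono, hp, hR, hcof, htd, hpt, hres⟩ := exists_branch hd hL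
      (fun n p q => ∀ C ∈ F ∪ E '' Set.Iic n, ∀ b ∈ C, p.len < b → b ≤ q.len →
        m + n ≤ num L (q.res b)) (by
      intro n p hp b hb
      obtain ⟨q, hq, hpq, H⟩ := exists_ext_of_le hL (max_lt hp.1 hb) (le_max_left p.len b) hp.2
        (F := F ∪ E '' Set.Iic n) (Set.union_subset hF (by
          rintro _ ⟨k, -, rfl⟩
          rw [hE]; exact ⟨k, rfl⟩)) (hF'.union ((Set.finite_Iic n).image E)) (m + n)
      have hqlen := (hL _ (max_lt hp.1 hb)).len_eq q hq
      refine ⟨q, mem_below hL (max_lt hp.1 hb) hq, hpq, hqlen ▸ le_max_right _ _, ?_⟩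
      rwa [hqlen]) hs
    -- Locates the stage at which the branch passes the height `b`; the bound imposed at that stage
    -- applies to `b`.
    have hstep : ∀ b < d, ∀ i, (p i).len < b → ∃ n, i ≤ n ∧ (p n).len < b ∧
        b ≤ (p (n + 1)).len := by
      intro b hb i hi
      classical
      have hex := hcof b hb
      have hpos : i < Nat.find hex := by
        by_contra! h
        exact ((Nat.find_spec hex).trans (len_mono (hmono h))).not_gt hi
      obtain ⟨n, hn⟩ : ∃ n, Nat.find hex = n + 1 := ⟨Nat.find hex - 1, by omega⟩
      refine ⟨n, by omega, not_le.1 (Nat.find_min hex (by omega)), ?_⟩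
      rw [← hn]; exact Nat.find_spec hex
    refine ⟨t, htd, hpt 0, hres, fun C hC k => ?_, fun C hC b hb hsb hbd => ?_⟩
    · obtain ⟨j, rfl⟩ : C ∈ Set.range E := hE ▸ hC
      -- From stage `j + k + 1` on, numbers on `E j` exceed `k`; earlier occurrences of `k` are
      -- finitely many by goodness of the level reached there.
      have hi := (hL _ (hp (j + k + 1)).1).finite _ (inter_Iic_mem_guessed hC _) _
        (hp (j + k + 1)).2 k
      refine hi.subset fun b hb => ?_
      have hble : b ≤ (p (j + k + 1)).len := by
        by_contra! h
        obtain ⟨n, hn, hnb, hnb'⟩ := hstep b hb.2.1 _ h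
        have := hR n (E j) (Or.inr ⟨j, by simp only [Set.mem_Iic]; omega, rfl⟩) b hb.1 hnb hnb'
        rw [res_congr (hpt (n + 1)) hnb', hb.2.2] at this
        omega
      refine ⟨⟨hb.1, hble⟩, ?_⟩
      rw [res_congr (hpt _) hble]
      exact hb.2.2
    · obtain ⟨n, -, hnb, hnb'⟩ := hstep b hbd 0 hsb
      have := hR n C (Or.inl hC) b hb hnb hnb'
      rw [res_congr (hpt (n + 1)) hnb'] at this
      omega
  choose! g hg hsg hres hfin hext using key
  set I : Set (BinSeq × Set (Set OmegaOne) × ℕ) :=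
    below L d ×ˢ ({F | F.Finite ∧ F ⊆ guessed A X d} ×ˢ Set.univ)
  have hIc : I.Countable := (countable_below hL).prod
    ((Set.countable_ofPred_finite_subset hG).prod Set.countable_univ)
  set l : Set BinSeq := (fun x => g x.1 x.2.1 x.2.2) '' I
  have hlc : l.Countable := hIc.image _
  refine ⟨l, isGoodLevel_limit hd hlc ?_ ?_ ?_ ?_ fun h => absurd h hdX⟩
  · rintro _ ⟨⟨s, F, m⟩, ⟨hs, ⟨hF', hF⟩, -⟩, rfl⟩
    exact hg s hs F hF hF' m
  · rintro _ ⟨⟨s, F, m⟩, ⟨hs, ⟨hF', hF⟩, -⟩, rfl⟩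
    exact hres s hs F hF hF' m
  · rintro C hC _ ⟨⟨s, F, m⟩, ⟨hs, ⟨hF', hF⟩, -⟩, rfl⟩
    exact hfin s hs F hF hF' m C hC
  · intro a ha s hs F hF hF' m
    -- The number at `d` itself depends on the enumeration of the whole new level. Only finitely
    -- many branches have a number below `m`; extending `s` off them passes no limit ordinal, hence
    -- no point of a set in `F`.
    have hB : {t ∈ l | enum l t < m}.Finite :=
      Set.Finite.of_finite_image ((Set.finite_Iio m).subset (by
        rintro _ ⟨t, ht, rfl⟩
        exact ht.2)) ((injOn_enum hlc).mono fun t ht => ht.1)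
    have hsa := (hL a ha).len_eq s hs
    obtain ⟨q, hq, hsq, hqb, hqB⟩ := exists_avoiding hd hL (mem_below hL ha hs) hB
    have hmem : g q F m ∈ l := ⟨(q, F, m), ⟨hq, ⟨hF', hF⟩, trivial⟩, rfl⟩
    have hqg := hsg q hq F hF hF' m
    refine ⟨_, hmem, hsq.trans hqg, fun C hC b hb hab hbd => ?_, fun _ => ?_⟩
    · exact hext q hq F hF hF' m C hC b hb
        (hqb b (hsa ▸ hab) ((hF hC).2.2 b hb).1) hbd
    · by_contra! h
      exact hqB _ ⟨hmem, h⟩ hqg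

theorem exists_isGoodLevel (hA : ∀ b, (A b).Countable) (hL : ∀ b < d, IsGoodLevel A c X L b) :
    ∃ l, IsGoodLevel A c X (Function.update L d l) d := by
  rcases isMin_or_mem_range_succ_or_isSuccLimit d with hd | ⟨a, rfl⟩ | hd
  · rw [isMin_iff_eq_bot] at hd
    subst hd
    exact exists_isGoodLevel_bot
  · exact exists_isGoodLevel_succ hL
  · by_cases hdX : d ∈ X
    · exact exists_isGoodLevel_of_mem hA hd hdX hL
    · exact exists_isGoodLevel_of_notMem hA hd hdX hL

theorem isGoodLevel (hA : ∀ b, (A b).Countable) (d : OmegaOne) :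
    IsGoodLevel A c X (levels A c X) d :=
  isGoodLevel_levels (fun _ _ hL => exists_isGoodLevel hA hL) d

/-! ### The resulting tree is a regular ℵ₁-tree. -/

/-- The tree with the given levels. -/
def tree (L : OmegaOne → Set BinSeq) : Set BinSeq := {t | t ∈ L t.len}

theorem res_mem_tree (hL : ∀ d, IsGoodLevel A c X L d) {t : BinSeq} (ht : t ∈ tree L)
    (ha : a ≤ t.len) : t.res a ∈ tree L :=
  (hL _).res_mem t ht a ha

theorem level_tree (hL : ∀ d, IsGoodLevel A c X L d) (d : OmegaOne) : level (tree L) d = L d := by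
  ext t
  constructor
  · rintro ⟨h, rfl⟩
    exact h
  · intro h
    have := (hL d).len_eq t h
    exact ⟨show t ∈ L t.len from this.symm ▸ h, this⟩

theorem exists_root (hL : ∀ d, IsGoodLevel A c X L d) :
    ∃ r ∈ L ⊥, ∀ t : BinSeq, r ≤ t := by
  obtain ⟨r, hr⟩ := (hL ⊥).nonempty rfl
  refine ⟨r, hr, fun t => le_iff.2 ?_⟩
  rw [(hL ⊥).len_eq r hr]
  exact ⟨bot_le, fun b hb => absurd hb not_lt_bot⟩

theorem isAlephOneSubtree_tree (hL : ∀ d, IsGoodLevel A c X L d) : IsAlephOneSubtree (tree L) where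
  isLowerSet t s hst ht := by
    rw [← res_eq_of_le hst]
    exact res_mem_tree hL ht (len_mono hst)
  countable_level d := by
    rw [level_tree hL]
    exact (hL d).countable
  nonempty_level d := by
    rw [level_tree hL]
    obtain ⟨r, hr, -⟩ := exists_root hL
    obtain ⟨t, ht, -⟩ := exists_extension (d := succ d) (fun b _ => hL b) (lt_succ d) bot_le hr
    exact ⟨t, ht⟩

theorem snoc_mem_tree (hL : ∀ d, IsGoodLevel A c X L d) {s : BinSeq} (hs : s ∈ tree L) (i : Bool) :
    snoc s i ∈ tree L :=
  (hL _).full _ rfl _ rfl (by rw [res_snoc]; exact hs)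

theorem isRegularTree_tree (hL : ∀ d, IsGoodLevel A c X L d) : IsRegularTree (tree L) where
  rooted := by
    obtain ⟨r, hr, h⟩ := exists_root hL
    rw [← level_tree hL] at hr
    exact ⟨r, hr.1, fun t _ => h t⟩
  splitting s hs := ⟨snoc s true, snoc_mem_tree hL hs _, snoc s false, snoc_mem_tree hL hs _,
    fun h => Bool.noConfusion (snoc_injective s h), covBy_snoc s _, covBy_snoc s _⟩
  pruned s hs d hd := by
    rw [level_tree hL]
    exact exists_extension (d := succ d) (fun b _ => hL b) (lt_succ d) hd.le hs

/-! ### Chains, antichains and specializing colours. -/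

/-- In a tree with splitting nodes, an uncountable chain gives rise to an uncountable antichain. -/
theorem countable_of_isChain_of_antichains {T : Set BinSeq}
    (hsnoc : ∀ s ∈ T, ∀ i, snoc s i ∈ T)
    (hT : ∀ S ⊆ T, IsAntichain (· ≤ ·) S → S.Countable) {B : Set BinSeq} (hB : B ⊆ T)
    (hchain : IsChain (· ≤ ·) B) : B.Countable := by
  have hle : ∀ s ∈ B, ∀ t ∈ B, s.len ≤ t.len → s ≤ t := fun s hs t ht h => by
    rcases hchain.total hs ht with h' | h'
    · exact h'
    · exact (eq_of_le_of_len_le h' h).ge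
  have hoff : ∀ s : BinSeq, ∃ i, ∀ t ∈ B, ¬ snoc s i ≤ t := by
    intro s
    by_contra! h
    obtain ⟨t, ht, hst⟩ := h true
    obtain ⟨u, hu, hsu⟩ := h false
    have : snoc s true = snoc s false := by
      rcases hchain.total ht hu with h' | h'
      · exact (res_eq_of_le (hst.trans h')).symm.trans (res_eq_of_le hsu)
      · exact (res_eq_of_le hst).symm.trans (res_eq_of_le (hsu.trans h'))
    exact Bool.noConfusion (snoc_injective s this)
  -- `o s` is a direction at `s` that leaves the chain; stepping off in these directions gives the
  -- antichain.
  choose o ho using hoff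
  have hinj : Set.InjOn (fun s => snoc s (o s)) B := by
    intro s hs t ht h
    have hlen : s.len = t.len := succ_injective (congrArg len h)
    exact le_antisymm (hle s hs t ht hlen.le) (hle t ht s hs hlen.ge)
  refine Set.countable_of_injective_of_countable_image hinj (hT _ ?_ ?_)
  · rintro _ ⟨s, hs, rfl⟩
    exact hsnoc s (hB hs) _
  · rintro _ ⟨s, hs, rfl⟩ _ ⟨t, ht, rfl⟩ hne h
    have hlen : s.len ≤ t.len := succ_le_succ_iff.1 (len_mono h)
    rcases hlen.eq_or_lt with hlen | hlen
    · exact hne (eq_of_le_of_len_le h (succ_le_succ hlen.ge))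
    · exact ho s t ht (le_of_le_of_len_le h (le_snoc t _) (succ_le_of_lt hlen))

theorem countable_of_isChain_of_special {T : Set BinSeq} {S : ℕ → Set BinSeq}
    (hS : ∀ n, IsAntichain (· ≤ ·) (S n)) (hT : T = ⋃ n, S n) {B : Set BinSeq} (hB : B ⊆ T)
    (hchain : IsChain (· ≤ ·) B) : B.Countable := by
  have : B = ⋃ n, B ∩ S n := by
    rw [← Set.inter_iUnion, ← hT, Set.inter_eq_left.2 hB]
  rw [this]
  refine Set.countable_iUnion fun n => Set.Subsingleton.countable fun s hs t ht => ?_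
  by_contra hne
  rcases hchain.total hs.1 ht.1 with h | h
  · exact hS n hs.2 ht.2 hne h
  · exact hS n ht.2 hs.2 (Ne.symm hne) h

theorem countable_of_isAntichain_tree (hL : ∀ d, IsGoodLevel A c X L d) (hc : Function.Injective c)
    (hA : ∀ S : Set OmegaOne, ∃ C, IsClub C ∧ ∀ a ∈ C, S ∩ Set.Iio a ∈ A a)
    (hX : IsStationary X) {B : Set BinSeq} (hB : B ⊆ tree L) (hanti : IsAntichain (· ≤ ·) B) :
    B.Countable := by
  -- `B` need not be maximal; adding the nodes incomparable with all of `B` makes the set predense.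
  set D : Set BinSeq := {t | t ∈ tree L ∧ ((∃ b ∈ B, b ≤ t) ∨ ∀ b ∈ B, ¬ b ≤ t ∧ ¬ t ≤ b)}
  have hpre : ∀ s ∈ tree L, ∃ t ∈ D, t ≤ s ∨ s ≤ t := by
    intro s hs
    by_cases h : ∃ b ∈ B, b ≤ s ∨ s ≤ b
    · obtain ⟨b, hb, h⟩ := h
      exact ⟨b, ⟨hB hb, Or.inl ⟨b, hb, le_rfl⟩⟩, h⟩
    · push Not at h
      exact ⟨s, ⟨hs, Or.inr h⟩, Or.inl le_rfl⟩
  choose! f hfD hf using hpre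
  obtain ⟨C, hC, hCA⟩ := hA ((fun t : BinSeq => c (t.len, num L t)) '' D)
  have h1 : ∀ a, ∃ b, ∀ n, c (a, n) < b := fun a => by
    obtain ⟨b, hb⟩ := OmegaOne.exists_forall_lt (Set.countable_range fun n => c (a, n))
    exact ⟨b, fun n => hb _ ⟨n, rfl⟩⟩
  choose g₁ hg₁ using h1
  have h2 : ∀ a, ∃ b, ∀ s ∈ L a, (f s).len < b := fun a => by
    obtain ⟨b, hb⟩ := OmegaOne.exists_forall_lt ((hL a).countable.image fun s => (f s).len)
    exact ⟨b, fun s hs => hb _ ⟨s, hs, rfl⟩⟩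
  choose g₂ hg₂ using h2
  -- At `d`, the code of `D` is guessed, codes of nodes below `d` are below `d`, and predensity of
  -- `D` is witnessed below `d`.
  obtain ⟨d, hdX, ⟨⟨hdC, hd₁⟩, hd₂⟩, hdl⟩ := hX
    (((hC.inter OmegaOne.cof_ne_aleph0 (OmegaOne.isClub_closurePoints g₁)).inter
      OmegaOne.cof_ne_aleph0 (OmegaOne.isClub_closurePoints g₂)).inter
      OmegaOne.cof_ne_aleph0 OmegaOne.isClub_isSuccLimit)
  have hseal := (hL d).sealing hdl hdX _ (hCA d hdC) (by
    intro s hs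
    have hfs : (f s).len < d := (hg₂ _ s hs.2).trans (hd₂ _ hs.1)
    exact ⟨f s, ⟨hfs, (hfD s hs.2).1⟩,
      ⟨⟨f s, hfD s hs.2, rfl⟩, (hg₁ _ _).trans (hd₁ _ hfs)⟩, hf s hs.2⟩)
  refine (countable_below (d := d) fun b _ => hL b).mono ?_
  refine fun b hb => ⟨?_, hB hb⟩
  -- If `b` reached level `d`, sealing would put a node of `D` of height below `d` under `b`. That
  -- node is incomparable with `b`, or lies above an element of `B` that must be `b` itself; both
  -- are impossible.
  by_contra! hdb
  obtain ⟨a, ha, ⟨⟨a', ha', haa'⟩, -⟩, hab⟩ := hseal _ ((hL _).res_mem b (hB hb) d hdb)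
  have hlen : a'.len = a.len := congrArg Prod.fst (hc haa')
  have hnum : num L a' = num L a := congrArg Prod.snd (hc haa')
  obtain rfl : a' = a := by
    rw [num, num, hlen] at hnum
    exact injOn_enum (hL a.len).countable (hlen ▸ ha'.1) ha.2 hnum
  have hab' : a' ≤ b := hab.trans (res_le hdb)
  rcases ha'.2 with ⟨x, hx, hxa⟩ | h
  · obtain rfl := hanti.eq hx hb (hxa.trans hab')
    exact (hdb.trans (len_mono hxa)).not_gt ha.1
  · exact (h b hb).2 hab'

theorem isSuslin_tree (hL : ∀ d, IsGoodLevel A c X L d) (hc : Function.Injective c)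
    (hA : ∀ S : Set OmegaOne, ∃ C, IsClub C ∧ ∀ a ∈ C, S ∩ Set.Iio a ∈ A a)
    (hX : IsStationary X) : IsSuslin (tree L) where
  isAronszajn := ⟨isAlephOneSubtree_tree hL, isRegularTree_tree hL, fun _ =>
    countable_of_isChain_of_antichains (fun _ hs => snoc_mem_tree hL hs) fun _ =>
      countable_of_isAntichain_tree hL hc hA hX⟩
  countable_of_isAntichain _ := countable_of_isAntichain_tree hL hc hA hX

theorem exists_special_tree (hL : ∀ d, IsGoodLevel A c X L d) {C : Set OmegaOne} (hC : IsClub C)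
    (hCA : ∀ a ∈ C, IsSuccLimit a ∧ a ∉ X ∧ C ∩ Set.Iio a ∈ A a) :
    ∃ S : ℕ → Set BinSeq, (∀ n, IsAntichain (· ≤ ·) (S n)) ∧ tree L = ⋃ n, S n := by
  -- With `⊥` added, every height has a greatest point of `C'` at or below it.
  set C' : Set OmegaOne := C ∪ {⊥}
  have hcl : DirSupClosed C' := hC.dirSupClosed.union (PartialOrder.dirSupClosed_singleton ⊥)
  have hfin : ∀ t ∈ tree L, ∀ k, {b ∈ C' | b ≤ t.len ∧ num L (t.res b) = k}.Finite := by
    intro t ht k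
    refine (((hL t.len).finite _ (inter_Iic_mem_guessed_of_dirSupClosed hC.dirSupClosed hCA t.len)
      t ht k).insert ⊥).subset ?_
    rintro b ⟨hb | hb, hbt, hbk⟩
    · exact Or.inr ⟨⟨hb, hbt⟩, hbk⟩
    · exact Or.inl hb
  have hgreatest : ∀ a, ∃ m, IsGreatest (C' ∩ Set.Iic a) m := fun a =>
    OmegaOne.exists_isGreatest hcl ⟨⊥, Or.inr rfl, Set.mem_Iic.2 bot_le⟩
  choose π hπ using hgreatest
  have hπle : ∀ a, π a ≤ a := fun a => (hπ a).1.2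
  have hblock : ∀ a, {t ∈ tree L | π t.len = a}.Countable := by
    intro a
    obtain ⟨d, hd, had⟩ := hC.isCofinal (succ a)
    refine (countable_below (d := d) fun b _ => hL b).mono ?_
    rintro t ⟨ht, rfl⟩
    refine ⟨?_, ht⟩
    by_contra! h
    exact ((succ_le_iff.1 had).trans_le ((hπ t.len).2 ⟨Or.inl hd, h⟩)).false
  let N : BinSeq → Set OmegaOne := fun t =>
    {b ∈ C' | b < π t.len ∧ num L (t.res b) = num L (t.res (π t.len))}
  -- The last entry separates nodes in the same block between consecutive points of `C'`, which is
  -- countable.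
  let color : BinSeq → ℕ × ℕ × ℕ := fun t =>
    (num L (t.res (π t.len)), (N t).ncard, enum {u ∈ tree L | π u.len = π t.len} t)
  have key : ∀ s ∈ tree L, ∀ t ∈ tree L, s ≤ t → color s = color t → s = t := by
    intro s hs t ht hst h
    have h1 : num L (s.res (π s.len)) = num L (t.res (π t.len)) := congrArg Prod.fst h
    have h2 : (N s).ncard = (N t).ncard := congrArg (fun x => x.2.1) h
    have h3 : enum {u ∈ tree L | π u.len = π s.len} s = enum {u ∈ tree L | π u.len = π t.len} t :=
      congrArg (fun x => x.2.2) h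
    have hle : π s.len ≤ π t.len := (hπ t.len).2 ⟨(hπ s.len).1.1, (hπle _).trans (len_mono hst)⟩
    rcases hle.eq_or_lt with heq | hlt
    · rw [heq] at h3
      exact injOn_enum (hblock (π t.len)) ⟨hs, heq⟩ ⟨ht, rfl⟩ h3
    · refine absurd h2 (Set.ncard_lt_ncard ?_ ?_).ne
      -- When the blocks differ but the numbers agree, `N t` contains `N s` and also the point `π
      -- s.len`.
      · refine Set.ssubset_iff_exists.2 ⟨?_, π s.len, ⟨(hπ s.len).1.1, hlt, ?_⟩, ?_⟩
        · rintro b ⟨hb, hbs, hbn⟩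
          refine ⟨hb, hbs.trans hlt, ?_⟩
          rw [← res_congr hst (hbs.le.trans (hπle _)), hbn, h1]
        · rw [← res_congr hst (hπle _), h1]
        · exact fun h => h.2.1.false
      · exact (hfin t ht _).subset fun b hb => ⟨hb.1, hb.2.1.le.trans (hπle _), hb.2.2⟩
  refine ⟨fun n => {t ∈ tree L | Encodable.encode (color t) = n}, ?_, ?_⟩
  · intro n s hs t ht hne hst
    exact hne (key s hs.1 t ht.1 hst (Encodable.encode_injective (hs.2.trans ht.2.symm)))
  · ext t
    simp

theorem isSpecialAronszajn_tree (hL : ∀ d, IsGoodLevel A c X L d) {C : Set OmegaOne}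
    (hC : IsClub C) (hCA : ∀ a ∈ C, IsSuccLimit a ∧ a ∉ X ∧ C ∩ Set.Iio a ∈ A a) :
    IsSpecialAronszajn (tree L) := by
  obtain ⟨S, hS, hT⟩ := exists_special_tree hL hC hCA
  exact ⟨⟨isAlephOneSubtree_tree hL, isRegularTree_tree hL, fun _ =>
    countable_of_isChain_of_special hS hT⟩, S, hS, hT⟩

end BinSeq

theorem mainTheorem4 (hDiamond : DiamondPlus) :
    ∃ T : Set OmegaOne → Set BinSeq,
      (∀ X, BinSeq.IsAlephOneSubtree (T X)) ∧
      (∀ (X Y : Set OmegaOne) (α : OmegaOne), X ∩ Set.Iio α = Y ∩ Set.Iio α →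
        BinSeq.restrict (T X) α = BinSeq.restrict (T Y) α) ∧
      (∀ X, IsStationary X → BinSeq.IsSuslin (T X)) ∧
      (∀ X, ¬ IsStationary X → BinSeq.IsSpecialAronszajn (T X)) := by
  obtain ⟨A₀, hA₀, hguess⟩ := hDiamond
  obtain ⟨c, hc⟩ := OmegaOne.exists_injective
  -- Pairwise intersections are included because the club used for special trees is an intersection
  -- of two sets guessed separately.
  let A : OmegaOne → Set (Set OmegaOne) := fun a => Set.image2 (· ∩ ·) (A₀ a) (A₀ a)
  have hA : ∀ a, (A a).Countable := fun a => (hA₀ a).image2 (hA₀ a) _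
  have hL : ∀ X d, BinSeq.IsGoodLevel A c X (BinSeq.levels A c X) d := fun X d =>
    BinSeq.isGoodLevel hA d
  refine ⟨fun X => BinSeq.tree (BinSeq.levels A c X),
    fun X => BinSeq.isAlephOneSubtree_tree (hL X), fun X Y α h => ?_, fun X hX => ?_,
    fun X hX => ?_⟩
  · ext t
    refine and_congr_left fun ht => ?_
    -- Level `t.len` depends on `X` up to and including `t.len`, which is still below `α`.
    have hXY : X ∩ Set.Iic t.len = Y ∩ Set.Iic t.len := by
      have hsub : Set.Iio α ∩ Set.Iic t.len = Set.Iic t.len :=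
        Set.inter_eq_right.2 fun x hx => lt_of_le_of_lt hx ht
      rw [← hsub, ← Set.inter_assoc, h, Set.inter_assoc]
    change t ∈ BinSeq.levels A c X t.len ↔ t ∈ BinSeq.levels A c Y t.len
    rw [BinSeq.levels_congr hXY]
  · refine BinSeq.isSuslin_tree (hL X) hc (fun S => ?_) hX
    obtain ⟨C, hC, h⟩ := hguess S
    exact ⟨C, hC, fun a ha => ⟨_, (h a ha).2, _, (h a ha).2, Set.inter_self _⟩⟩
  · obtain ⟨E, hE, hXE⟩ := not_isStationary_iff.1 hX
    have hE' := hE.inter OmegaOne.cof_ne_aleph0 OmegaOne.isClub_isSuccLimit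
    -- Guessing is applied to a club of limits missing `X`, not to `X`; intersecting it with the
    -- guessing club gives a club guessed at all its points.
    obtain ⟨C, hC, h⟩ := hguess (E ∩ {a | IsSuccLimit a})
    refine BinSeq.isSpecialAronszajn_tree (hL X) (hC.inter OmegaOne.cof_ne_aleph0 hE')
      fun a ha => ⟨ha.2.2, fun haX => Set.disjoint_left.1 hXE haX ha.2.1,
        ⟨_, (h a ha.1).1, _, (h a ha.1).2, ?_⟩⟩
    exact (Set.inter_inter_distrib_right _ _ _).symm
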